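/- For $n\ge 2$ let $NC(n,2)$ be the set of noncrossing partitions of $[n]=\{1,\dots,n\}$ into exactly two blocks, where a partition is identified with its restricted growth function $\rho\in\{1,2\}^n$ ($\rho_i=1$ if $i$ is in the block of $1$, and $\rho_i=2$ otherwise). Let $f(\rho)$ and $l(\rho)$ be the positions of the first and of the last letter $2$ in $\rho$, and order $NC(n,2)$ by $\rho\le\sigma$ iff $f(\rho)\le f(\sigma)$ and $l(\rho)\le l(\sigma)$. Let $\alpha_n: NC(n,2)\to NC(n-1,2)$ ($n\ge 3$) be the map that restricts a partition to $[n-1]$, i.e. deletes the last letter of $\rho$, except that $1^{n-1}2$, whose restriction has only one block, is mapped to $1^{n-2}2$. A graph is a set of vertices with a reflexive symmetric edge relation; an epimorphism maps edges to edges and is surjective on vertices and on edges. A topological graph has a zero-dimensional compact second countable (Hausdorff) vertex space and a closed edge relation; its epimorphisms are required to be continuous. A set $S$ of vertices is connected if it is not the union of two nonempty disjoint relatively closed subsets with no edge between them. An epimorphism is monotone if preimages of closed connected sets are connected. A topological graph is Kelley if it is nonempty and connected and, for every closed connected set $K$, every $a\in K$ and every sequence of vertices $a_m\to a$, there are closed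 connected sets $K_m\ni a_m$ with $K_m\to K$ in the Vietoris topology (equivalently, in the Hausdorff metric). A projective Fraïssé family is a nonempty family of finite graphs with a fixed family of epimorphisms between them, such that: it is countable up to isomorphism; the epimorphisms contain the identities and are closed under composition; any two members $B,C$ admit epimorphisms $D\to B$, $D\to C$ of the family from one member $D$; and for any epimorphisms $f:B\to A$, $g:C\to A$ of the family there are epimorphisms $f_0:D\to B$, $g_0:D\to C$ of the family with $f f_0=g g_0$. Regard each $NC(n,2)$ as a graph through its Hasse diagram (with a loop at every vertex). Then: 1. Each $NC(n,2)$, $n\ge 2$, is a finite nonempty lattice. For $n\ge 3$ it contains a copy of $NC(n-1,2)$: there is an embedding of posets and of graphs $e: NC(n-1,2)\to NC(n,2)$ with $\alpha_n\circ e=\mathrm{id}$. 2. Each $\alpha_n$, $n\ge 3$, is order preserving and a monotone epimorphism of graphs. 3. The lattices $NC(n,2)$, $n\ge 2$, with the identities and the compositions of the maps $\alpha_n$, form a projective Fraïssé family. 4. Let $N=\varprojlim (NC(n,2),\alpha_n)$, with the subspace topology of the product of the discrete spaces $NC(n,2)$, two elements forming an edge iff their projections to every $NC(n,2)$ form an edge.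 Then $N$ is a topological graph, every canonical projection $N\to NC(n,2)$ is a monotone epimorphism (in particular continuous), and $N$ is Kelley. -/

import Mathlib

open Set Filter Topology

/-! ### Graphs in the sense of projective Fraïssé theory -/

/-- A graph on the vertex set `V`: a reflexive and symmetric relation on `V`. -/
structure ReflGraph (V : Type*) where
  Adj : V → V → Prop
  refl : ∀ a, Adj a a
  symm : ∀ a b, Adj a b → Adj b a

namespace ReflGraph

/-- An epimorphism of graphs: it maps edges to edges and is surjective on vertices and on edges. -/
structure IsEpi {V W : Type*} (G : ReflGraph V) (H : ReflGraph W) (f : V → W) : Prop where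
  hom : ∀ a b, G.Adj a b → H.Adj (f a) (f b)
  surj : Function.Surjective f
  surj_edge : ∀ c d, H.Adj c d → ∃ a b, G.Adj a b ∧ f a = c ∧ f b = d

/-- An isomorphism is an injective epimorphism. -/
def Iso {V W : Type*} (G : ReflGraph V) (H : ReflGraph W) : Prop :=
  ∃ f : V → W, IsEpi G H f ∧ Function.Injective f

/-- A topological graph: the vertex set is a zero-dimensional (there is a basis of clopen sets),
compact, second countable Hausdorff space and the edge relation is closed. -/
structure IsTopologicalGraph {V : Type*} [TopologicalSpace V] (G : ReflGraph V) : Prop where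
  compact : CompactSpace V
  hausdorff : T2Space V
  zeroDim : TopologicalSpace.IsTopologicalBasis {U : Set V | IsClopen U}
  secondCountable : SecondCountableTopology V
  closed_edges : IsClosed {e : V × V | G.Adj e.1 e.2}

/-- A set `S` of vertices of a (topological) graph is connected if it is not the union of two
nonempty disjoint relatively closed subsets with no edge between them.  (If the two
pieces `S ∩ C` and `S ∩ D` meet, then a degenerate edge joins them.) -/
def IsConn {V : Type*} [TopologicalSpace V] (G : ReflGraph V) (S : Set V) : Prop :=
  ∀ C D : Set V, IsClosed C → IsClosed D → S ⊆ C ∪ D → (S ∩ C).Nonempty → (S ∩ D).Nonempty →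
    ∃ a ∈ S ∩ C, ∃ b ∈ S ∩ D, G.Adj a b

/-- A monotone epimorphism of topological graphs: a continuous epimorphism such that preimages
of closed connected sets are connected. -/
structure IsMonotoneEpi {V W : Type*} [TopologicalSpace V] [TopologicalSpace W]
    (G : ReflGraph V) (H : ReflGraph W) (f : V → W) : Prop where
  epi : IsEpi G H f
  continuous : Continuous f
  monotone : ∀ Q : Set W, IsClosed Q → H.IsConn Q → G.IsConn (f ⁻¹' Q)

/-- Convergence of a sequence of closed sets in the Vietoris topology (for compact metrizable
spaces and nonempty closed sets this is convergence in the Hausdorff metric). -/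
def VietorisTendsto {V : Type*} [TopologicalSpace V] (K : ℕ → Set V) (L : Set V) : Prop :=
  (∀ U : Set V, IsOpen U → L ⊆ U → ∀ᶠ n in atTop, K n ⊆ U) ∧
  (∀ U : Set V, IsOpen U → (L ∩ U).Nonempty → ∀ᶠ n in atTop, (K n ∩ U).Nonempty)

/-- A topological graph is Kelley if it is connected and, for every closed connected set `K`, every
vertex `a ∈ K` and every sequence of vertices `u n → a`, there are closed connected
sets `L n ∋ u n` converging to `K`. -/
structure IsKelley {V : Type*} [TopologicalSpace V] (G : ReflGraph V) : Prop where
  nonempty : Nonempty V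
  conn : G.IsConn univ
  kelley : ∀ K : Set V, IsClosed K → G.IsConn K → ∀ a ∈ K, ∀ u : ℕ → V, Tendsto u atTop (𝓝 a) →
    ∃ L : ℕ → Set V, (∀ n, IsClosed (L n) ∧ G.IsConn (L n) ∧ u n ∈ L n) ∧ VietorisTendsto L K

/-- A family `G i` of finite graphs, together with a fixed family `Mor` of maps between them, is a
projective Fraïssé family of graphs and epimorphisms. -/
structure IsProjectiveFraisse {ι : Type*} {V : ι → Type*} (G : ∀ i, ReflGraph (V i))
    (Mor : ∀ i j, (V i → V j) → Prop) : Prop where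
  nonempty : Nonempty ι
  finite : ∀ i, Finite (V i)
  epi : ∀ i j f, Mor i j f → IsEpi (G i) (G j) f
  countable : ∀ S : Set ι, S.Pairwise (fun i j => ¬ Iso (G i) (G j)) → S.Countable
  id_mem : ∀ i, Mor i i id
  comp_mem : ∀ i j k f g, Mor i j f → Mor j k g → Mor i k (g ∘ f)
  joint : ∀ b c, ∃ d f g, Mor d b f ∧ Mor d c g
  amalgamation : ∀ a b c f g, Mor b a f → Mor c a g →
    ∃ d f₀ g₀, Mor d b f₀ ∧ Mor d c g₀ ∧ f ∘ f₀ = g ∘ g₀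

/-- The Hasse diagram of a poset, as a reflexive graph. -/
def hasse (P : Type*) [PartialOrder P] : ReflGraph P where
  Adj x y := x = y ∨ x ⋖ y ∨ y ⋖ x
  refl _ := Or.inl rfl
  symm _ _ h := h.elim (fun h => Or.inl h.symm) (fun h => Or.inr h.symm)

end ReflGraph

/-! ### Inverse sequences and their limits -/

section InverseSequence

variable {V : ℕ → Type*} (α : ∀ n, V (n + 1) → V n)

/-- The maps generated by an inverse sequence: identities and compositions of bonding maps. -/
inductive BondingComp : ∀ i j : ℕ, (V i → V j) → Prop
  | id (i : ℕ) : BondingComp i i id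
  | step (i j : ℕ) (f : V i → V (j + 1)) : BondingComp i (j + 1) f → BondingComp i j (α j ∘ f)

/-- The inverse limit of an inverse sequence (as a subspace of the product). -/
def InvLimit : Type _ := {x : ∀ n, V n // ∀ n, α n (x (n + 1)) = x n}

instance [∀ n, TopologicalSpace (V n)] : TopologicalSpace (InvLimit α) :=
  inferInstanceAs (TopologicalSpace {x : ∀ n, V n // ∀ n, α n (x (n + 1)) = x n})

/-- The canonical projection of the inverse limit onto the `n`-th factor. -/
def InvLimit.proj (n : ℕ) (x : InvLimit α) : V n := x.1 n

/-- The graph structure of the inverse limit: an edge is a pair that projects to an edge in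
every factor. -/
def InvLimit.graph (G : ∀ n, ReflGraph (V n)) : ReflGraph (InvLimit α) where
  Adj x y := ∀ n, (G n).Adj (InvLimit.proj α n x) (InvLimit.proj α n y)
  refl _ n := (G n).refl _
  symm _ _ h n := (G n).symm _ _ (h n)

end InverseSequence

/-! ### Noncrossing partitions -/

/-- A set partition of `[n]`, given as an equivalence relation, is noncrossing if there are no
`a < b < c < d` with `a, c` in one block and `b, d` in another one. -/
def Noncrossing {n : ℕ} (s : Setoid (Fin n)) : Prop :=
  ∀ a b c d : Fin n, a < b → b < c → c < d → s a c → s b d → s a b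

/-- `NC n k` is the set of noncrossing partitions of `[n]` into exactly `k` blocks (`Fin n` stands
for `[n]`, the element `i` for `i + 1`). -/
def NC (n k : ℕ) : Type :=
  {s : Setoid (Fin n) // Noncrossing s ∧ Nat.card (Quotient s) = k}

/-- The finite sets `NC n k` carry the discrete topology. -/
instance (n k : ℕ) : TopologicalSpace (NC n k) := ⊥

namespace NC

/-- The positions of the letter `2` in the restricted growth function of a partition with two
blocks, that is, the block that does not contain the least element. -/
def twos {n : ℕ} (π : NC n 2) : Set ℕ :=
  {i | ∃ h : i < n, ¬ π.1 ⟨0, Nat.zero_lt_of_lt h⟩ ⟨i, h⟩}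

/-- The position of the first occurrence of the letter `2`. -/
noncomputable def firstTwo {n : ℕ} (π : NC n 2) : ℕ := sInf π.twos

/-- The position of the last occurrence of the letter `2`; all remaining letters after it
are `1`. -/
noncomputable def lastTwo {n : ℕ} (π : NC n 2) : ℕ := sSup π.twos

theorem two_classes {n : ℕ} (π : NC n 2) (x y z : Fin n) : π.1 x y ∨ π.1 y z ∨ π.1 x z := by
  by_contra! h
  obtain ⟨a, b, -, hu⟩ := Nat.card_eq_two_iff.mp π.2.2
  have key : ∀ w : Quotient π.1, w = a ∨ w = b := fun w => by
    have : w ∈ ({a, b} : Set _) := hu ▸ mem_univ w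
    simpa using this
  have e1 : (Quotient.mk π.1 x) ≠ Quotient.mk π.1 y := fun e => h.1 (Quotient.exact e)
  have e2 : (Quotient.mk π.1 y) ≠ Quotient.mk π.1 z := fun e => h.2.1 (Quotient.exact e)
  have e3 : (Quotient.mk π.1 x) ≠ Quotient.mk π.1 z := fun e => h.2.2 (Quotient.exact e)
  rcases key (Quotient.mk π.1 x) with h1 | h1 <;> rcases key (Quotient.mk π.1 y) with h2 | h2 <;>
    rcases key (Quotient.mk π.1 z) with h3 | h3 <;> simp_all

theorem twos_nonempty {n : ℕ} (π : NC n 2) : π.twos.Nonempty := by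
  obtain ⟨a, b, hab, -⟩ := Nat.card_eq_two_iff.mp π.2.2
  induction a using Quotient.inductionOn with | _ x
  induction b using Quotient.inductionOn with | _ y
  by_contra h
  rw [Set.not_nonempty_iff_eq_empty] at h
  have key : ∀ i : Fin n, π.1 ⟨0, Fin.pos i⟩ i := fun i => by
    by_contra hi
    have : (i : ℕ) ∈ π.twos := ⟨i.2, hi⟩
    simp [h] at this
  exact hab (Quotient.sound (π.1.trans (π.1.symm (key x)) (key y)))

theorem twos_bddAbove {n : ℕ} (π : NC n 2) : BddAbove π.twos :=
  ⟨n, fun _ ⟨h, _⟩ => h.le⟩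

theorem mem_twos_iff {n : ℕ} (π : NC n 2) (i : ℕ) :
    i ∈ π.twos ↔ π.firstTwo ≤ i ∧ i ≤ π.lastTwo := by
  have hp : π.firstTwo ∈ π.twos := Nat.sInf_mem π.twos_nonempty
  have hq : π.lastTwo ∈ π.twos := Nat.sSup_mem π.twos_nonempty π.twos_bddAbove
  refine ⟨fun h => ⟨Nat.sInf_le h, le_csSup π.twos_bddAbove h⟩, fun ⟨h1, h2⟩ => ?_⟩
  rcases h1.eq_or_lt with h1 | h1
  · exact h1 ▸ hp
  rcases h2.eq_or_lt with h2 | h2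
  · exact h2 ▸ hq
  obtain ⟨hpn, hp⟩ := hp
  obtain ⟨hqn, hq⟩ := hq
  refine ⟨h2.trans hqn, fun h0 => hp ?_⟩
  have hpos : 0 < π.firstTwo := by
    rcases Nat.eq_zero_or_pos π.firstTwo with h | h
    · exact absurd (by simp only [h]; exact π.1.refl _) hp
    · exact h
  refine π.2.1 ⟨0, _⟩ ⟨π.firstTwo, hpn⟩ ⟨i, h2.trans hqn⟩ ⟨π.lastTwo, hqn⟩ hpos h1 h2 h0 ?_
  rcases π.two_classes ⟨0, Nat.zero_lt_of_lt hpn⟩ ⟨π.firstTwo, hpn⟩ ⟨π.lastTwo, hqn⟩ with h | h | h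
  · exact absurd h hp
  · exact h
  · exact absurd h hq

theorem rel_iff {n : ℕ} (π : NC n 2) (x y : Fin n) :
    π.1 x y ↔ ((x : ℕ) ∈ π.twos ↔ (y : ℕ) ∈ π.twos) := by
  have h0 : ∀ i : Fin n, (i : ℕ) ∈ π.twos ↔ ¬ π.1 ⟨0, Fin.pos x⟩ i := fun i =>
    ⟨fun ⟨_, h⟩ => h, fun h => ⟨i.2, h⟩⟩
  rw [h0, h0, not_iff_not]
  refine ⟨fun h => ⟨fun h' => π.1.trans h' h, fun h' => π.1.trans h' (π.1.symm h)⟩, fun h => ?_⟩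
  rcases π.two_classes ⟨0, Fin.pos x⟩ x y with h1 | h1 | h1
  · exact π.1.trans (π.1.symm h1) (h.1 h1)
  · exact h1
  · exact π.1.trans (π.1.symm (h.2 h1)) h1

/-- The order of `NC n 2`: compare the first and the last occurrences of the letter `2`
componentwise. -/
noncomputable instance (n : ℕ) : PartialOrder (NC n 2) where
  le π σ := π.firstTwo ≤ σ.firstTwo ∧ π.lastTwo ≤ σ.lastTwo
  le_refl _ := ⟨le_rfl, le_rfl⟩
  le_trans _ _ _ h h' := ⟨h.1.trans h'.1, h.2.trans h'.2⟩
  le_antisymm π σ h h' := by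
    have h1 := le_antisymm h.1 h'.1
    have h2 := le_antisymm h.2 h'.2
    refine Subtype.ext (Setoid.ext fun x y => ?_)
    rw [rel_iff, rel_iff, mem_twos_iff, mem_twos_iff, mem_twos_iff, mem_twos_iff, h1, h2]

/-- The partition of `[n + 2]` with blocks `{1, …, n + 1}` and `{n + 2}`. -/
def lastSingleton (n : ℕ) : NC (n + 2) 2 :=
  ⟨Setoid.ker (fun i : Fin (n + 2) => i = Fin.last (n + 1)), by
    intro a b c d hab hbc hcd h1 h2
    simp only [Setoid.ker_def, eq_iff_iff, Fin.ext_iff, Fin.val_last, Fin.lt_def] at *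
    omega, by
    have hs : Function.Surjective (fun i : Fin (n + 2) => i = Fin.last (n + 1)) := by
      intro p
      by_cases hp : p
      · exact ⟨Fin.last _, by simp [hp]⟩
      · refine ⟨0, ?_⟩
        simp only [hp, eq_iff_iff, iff_false, Fin.ext_iff, Fin.val_last, Fin.val_zero]
        omega
    rw [Nat.card_congr (Setoid.quotientKerEquivOfSurjective _ hs)]
    simp⟩

theorem noncrossing_restrict {n : ℕ} (s : Setoid (Fin (n + 1))) (h : Noncrossing s) :
    Noncrossing (s.comap Fin.castSucc) :=
  fun a b c d hab hbc hcd h1 h2 =>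
    h a.castSucc b.castSucc c.castSucc d.castSucc hab hbc hcd h1 h2

open Classical in
/-- The bonding map `NC(n + 3, 2) → NC(n + 2, 2)`: restrict a partition of `[n + 3]` to `[n + 2]`,
that is, delete the last letter of its restricted growth function.  The only partition
whose restriction does not have two blocks, `1 ⋯ 1 1 2`, is mapped to `1 ⋯ 1 2`. -/
noncomputable def bond (n : ℕ) (π : NC (n + 3) 2) : NC (n + 2) 2 :=
  if h : Nat.card (Quotient (π.1.comap Fin.castSucc)) = 2 then
    ⟨π.1.comap Fin.castSucc, noncrossing_restrict π.1 π.2.1, h⟩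
  else lastSingleton n

end NC

/-- The lattice `NC(n + 2, 2)`, as the `n`-th term of an inverse sequence. -/
abbrev NCTwo (n : ℕ) : Type := NC (n + 2) 2

/-- The projective limit of the sequence `NC(2, 2) ← NC(3, 2) ← NC(4, 2) ← ⋯`. -/
abbrev NCLimit : Type := InvLimit (V := NCTwo) NC.bond

/-- The graph structure on the projective limit of the Hasse diagrams of the `NC(n, 2)`. -/
noncomputable def ncLimitGraph : ReflGraph NCLimit :=
  InvLimit.graph (V := NCTwo) NC.bond (fun n => ReflGraph.hasse (NCTwo n))

/-! Noncrossing forces the letters `2` to fill an interval, so a partition of `[n]` into two blocks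
is a pair `(f, l)` with `1 ≤ f ≤ l ≤ n - 1` (positions count from `0`). The order is the product
order on this triangle, which is closed under componentwise `min` and `max`; covers are unit steps
in one coordinate; and the bonding map truncates both coordinates, the exceptional value included
(`bond_coords`). A fibre of a bonding map is therefore joined by unit steps, and an epimorphism of
finite graphs with connected fibres is monotone.

The rest is formal. Points of the limit lift every vertex and edge, so between two levels there is
only one generated map and amalgamation is automatic. Monotonicity passes to the limit by
compactness (`InvLimit.isMonotoneEpi_proj`). Fibres of the projections are then arbitrarily small
connected clopen neighbourhoods, and adding to `K` a shrinking fibre around `a` that contains `u m`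
gives the Kelley property. -/

instance (n k : ℕ) : DiscreteTopology (NC n k) := ⟨rfl⟩

instance (n k : ℕ) : Finite (NC n k) := by
  have : Finite (Setoid (Fin n)) :=
    Finite.of_injective (fun s : Setoid (Fin n) => fun x y => s x y)
      fun s t h => Setoid.ext fun x y => by
        have := congrFun (congrFun h x) y
        simpa using this
  exact inferInstanceAs (Finite {s : Setoid (Fin n) // _})

/-! ### Connectedness and epimorphisms -/

namespace ReflGraph

variable {V W X : Type*}

theorem IsEpi.id (G : ReflGraph V) : IsEpi G G id :=
  ⟨fun _ _ h => h, Function.surjective_id, fun c d h => ⟨c, d, h, rfl, rfl⟩⟩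

theorem IsEpi.comp {G : ReflGraph V} {H : ReflGraph W} {K : ReflGraph X} {g : W → X} {f : V → W}
    (hg : IsEpi H K g) (hf : IsEpi G H f) : IsEpi G K (g ∘ f) := by
  refine ⟨fun a b h => hg.hom _ _ (hf.hom _ _ h), hg.surj.comp hf.surj, fun c d h => ?_⟩
  obtain ⟨c', d', h', rfl, rfl⟩ := hg.surj_edge c d h
  obtain ⟨a, b, h'', rfl, rfl⟩ := hf.surj_edge c' d' h'
  exact ⟨a, b, h'', rfl, rfl⟩

variable [TopologicalSpace V] [TopologicalSpace W] [TopologicalSpace X]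

theorem IsMonotoneEpi.id (G : ReflGraph V) : IsMonotoneEpi G G id :=
  ⟨IsEpi.id G, continuous_id, fun _ _ h => h⟩

theorem IsMonotoneEpi.comp {G : ReflGraph V} {H : ReflGraph W} {K : ReflGraph X}
    {g : W → X} {f : V → W} (hg : IsMonotoneEpi H K g) (hf : IsMonotoneEpi G H f) :
    IsMonotoneEpi G K (g ∘ f) :=
  ⟨hg.epi.comp hf.epi, hg.continuous.comp hf.continuous, fun Q hQ h =>
    hf.monotone _ (hQ.preimage hg.continuous) (hg.monotone Q hQ h)⟩

theorem isConn_singleton (G : ReflGraph V) (a : V) : G.IsConn {a} := by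
  rintro C D - - - ⟨x, rfl, hx⟩ ⟨y, rfl, hy⟩
  exact ⟨_, ⟨rfl, hx⟩, _, ⟨rfl, hy⟩, G.refl _⟩

/-- If no edge joined the two pieces, each of `S` and `T` would lie entirely in the piece that
contains the common point `a`. -/
theorem IsConn.union {G : ReflGraph V} {S T : Set V} (hS : G.IsConn S) (hT : G.IsConn T)
    {a : V} (haS : a ∈ S) (haT : a ∈ T) : G.IsConn (S ∪ T) := by
  intro C D hC hD hsub hCn hDn
  by_contra! hno
  have hS' : ∀ c ∈ S ∩ C, ∀ d ∈ S ∩ D, ¬ G.Adj c d :=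
    fun c hc d hd => hno c ⟨Or.inl hc.1, hc.2⟩ d ⟨Or.inl hd.1, hd.2⟩
  have hT' : ∀ c ∈ T ∩ C, ∀ d ∈ T ∩ D, ¬ G.Adj c d :=
    fun c hc d hd => hno c ⟨Or.inr hc.1, hc.2⟩ d ⟨Or.inr hd.1, hd.2⟩
  have hST : ∀ R, G.IsConn R → R ⊆ S ∪ T → (∀ c ∈ R ∩ C, ∀ d ∈ R ∩ D, ¬ G.Adj c d) →
      a ∈ R → (a ∈ C → ∀ x ∈ R, x ∉ D) ∧ (a ∈ D → ∀ x ∈ R, x ∉ C) := by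
    intro R hR hRs hRn haR
    refine ⟨fun ha x hx hxD => ?_, fun ha x hx hxC => ?_⟩
    · obtain ⟨c, hc, d, hd, h⟩ := hR C D hC hD (hRs.trans hsub) ⟨a, haR, ha⟩ ⟨x, hx, hxD⟩
      exact hRn c hc d hd h
    · obtain ⟨c, hc, d, hd, h⟩ := hR C D hC hD (hRs.trans hsub) ⟨x, hx, hxC⟩ ⟨a, haR, ha⟩
      exact hRn c hc d hd h
  have kS := hST S hS subset_union_left hS' haS
  have kT := hST T hT subset_union_right hT' haT
  obtain ⟨x, hx, hxC⟩ := hCn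
  obtain ⟨y, hy, hyD⟩ := hDn
  rcases hsub (Or.inl haS) with ha | ha
  · exact hy.elim (fun hy => kS.1 ha y hy hyD) fun hy => kT.1 ha y hy hyD
  · exact hx.elim (fun hx => kS.2 ha x hx hxC) fun hx => kT.2 ha x hx hxC

/-- An epimorphism from a discrete graph is monotone if any two elements of a fibre are joined by a
path in that fibre. -/
theorem IsEpi.isMonotoneEpi_of_fibers [DiscreteTopology V] [DiscreteTopology W] {G : ReflGraph V}
    {H : ReflGraph W} {f : V → W} (hf : IsEpi G H f)
    (hfib : ∀ x y, f x = f y → Relation.ReflTransGen (fun a b => G.Adj a b ∧ f b = f a) x y) :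
    IsMonotoneEpi G H f := by
  refine ⟨hf, continuous_of_discreteTopology, fun Q _ hQ C D _ _ hsub hCn hDn => ?_⟩
  by_contra! hno
  -- With no edge between the pieces, a path inside a fibre over `Q` cannot leave `C`: over `Q`, the
  -- set `C` is a union of whole fibres.
  have key : ∀ x y, f x = f y → f x ∈ Q → x ∈ C → y ∈ C := by
    intro x y hxy hxQ hxC
    have : f y ∈ Q ∧ y ∈ C := by
      have h := hfib x y hxy
      clear hxy
      induction h with
      | refl => exact ⟨hxQ, hxC⟩
      | tail _ h ih =>
        have hb := h.2 ▸ ih.1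
        refine ⟨hb, (hsub hb).resolve_right fun hD => ?_⟩
        exact hno _ ⟨ih.1, ih.2⟩ _ ⟨hb, hD⟩ h.1
    exact this.2
  obtain ⟨x, hxQ, hxC⟩ := hCn
  obtain ⟨y, hyQ, hyD⟩ := hDn
  -- The images of the two pieces cover `Q`. An edge between them lifts to an edge of `G`, and by
  -- `key` its ends lie in `C` and outside `C`, a contradiction.
  obtain ⟨_, ⟨hcQ, c, hcC, rfl⟩, _, ⟨hdQ, d, hdD, rfl⟩, hcd⟩ :=
    hQ (f '' (C ∩ f ⁻¹' Q)) (f '' (f ⁻¹' Q \ C)) (isClosed_discrete _) (isClosed_discrete _)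
      (fun q hq => by
        obtain ⟨z, rfl⟩ := hf.surj q
        by_cases hz : z ∈ C
        · exact Or.inl ⟨z, ⟨hz, hq⟩, rfl⟩
        · exact Or.inr ⟨z, ⟨hq, hz⟩, rfl⟩)
      ⟨f x, hxQ, x, ⟨hxC, hxQ⟩, rfl⟩
      ⟨f y, hyQ, y, ⟨hyQ, fun hyC => hno y ⟨hyQ, hyC⟩ y ⟨hyQ, hyD⟩ (G.refl y)⟩, rfl⟩
  obtain ⟨a, b, hab, hac, hbd⟩ := hf.surj_edge _ _ hcd
  have haQ : f a ∈ Q := hac ▸ hcQ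
  have hbQ : f b ∈ Q := hbd ▸ hdQ
  refine hno a ⟨haQ, key c a hac.symm hcQ hcC.1⟩ b ⟨hbQ, (hsub hbQ).resolve_left fun hb => ?_⟩ hab
  exact hdD.2 (key b d hbd hbQ hb)

end ReflGraph

/-! ### Inverse limits of finite graphs -/

namespace BondingComp

variable {V : ℕ → Type*} {α : ∀ n, V (n + 1) → V n}

theorem comp {i j k : ℕ} {f : V i → V j} {g : V j → V k} (hf : BondingComp α i j f)
    (hg : BondingComp α j k g) : BondingComp α i k (g ∘ f) := by
  induction hg with
  | id => exact hf
  | step k g _ ih => exact step _ k (g ∘ f) ih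

theorem exists_of_le {i j : ℕ} (h : j ≤ i) : ∃ f, BondingComp α i j f := by
  induction h using Nat.decreasingInduction with
  | self => exact ⟨_, id i⟩
  | of_succ k _ ih =>
    obtain ⟨f, hf⟩ := ih
    exact ⟨_, step i k f hf⟩

/-- On points of the limit a generated map is determined by its source and target. When the
projections are surjective, this makes parallel generated maps equal. -/
theorem apply_proj {i j : ℕ} {f : V i → V j} (hf : BondingComp α i j f) (x : InvLimit α) :
    f (InvLimit.proj α i x) = InvLimit.proj α j x := by
  induction hf with
  | id => rfl
  | step j f _ ih => exact (congrArg (α j) ih).trans (x.2 j)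

theorem isEpi {G : ∀ n, ReflGraph (V n)} (h : ∀ n, ReflGraph.IsEpi (G (n + 1)) (G n) (α n))
    {i j : ℕ} {f : V i → V j} (hf : BondingComp α i j f) : ReflGraph.IsEpi (G i) (G j) f := by
  induction hf with
  | id => exact ReflGraph.IsEpi.id _
  | step j f _ ih => exact (h j).comp ih

theorem isMonotoneEpi [∀ n, TopologicalSpace (V n)] {G : ∀ n, ReflGraph (V n)}
    (h : ∀ n, ReflGraph.IsMonotoneEpi (G (n + 1)) (G n) (α n))
    {i j : ℕ} {f : V i → V j} (hf : BondingComp α i j f) :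
    ReflGraph.IsMonotoneEpi (G i) (G j) f := by
  induction hf with
  | id => exact ReflGraph.IsMonotoneEpi.id _
  | step j f _ ih => exact (h j).comp ih

/-- The terms of an inverse sequence of finite graphs form a projective Fraïssé family. -/
theorem isProjectiveFraisse [∀ n, Finite (V n)] {G : ∀ n, ReflGraph (V n)}
    (h : ∀ n, ReflGraph.IsEpi (G (n + 1)) (G n) (α n))
    (hsurj : ∀ n, Function.Surjective (InvLimit.proj α n)) :
    ReflGraph.IsProjectiveFraisse G (BondingComp α) where
  nonempty := ⟨0⟩
  finite := inferInstance
  epi _ _ _ hf := hf.isEpi h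
  countable S _ := S.to_countable
  id_mem := id
  comp_mem _ _ _ _ _ hf hg := hf.comp hg
  joint b c := by
    obtain ⟨f, hf⟩ := exists_of_le (α := α) (le_max_left b c)
    obtain ⟨g, hg⟩ := exists_of_le (α := α) (le_max_right b c)
    exact ⟨_, f, g, hf, hg⟩
  amalgamation a b c f g hf hg := by
    obtain ⟨f₀, hf₀⟩ := exists_of_le (α := α) (le_max_left b c)
    obtain ⟨g₀, hg₀⟩ := exists_of_le (α := α) (le_max_right b c)
    refine ⟨_, f₀, g₀, hf₀, hg₀, funext fun x => ?_⟩
    obtain ⟨x, rfl⟩ := hsurj _ x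
    rw [(hf₀.comp hf).apply_proj, (hg₀.comp hg).apply_proj]

end BondingComp

namespace InvLimit

variable {V : ℕ → Type*} {α : ∀ n, V (n + 1) → V n}

theorem proj_eq_of_le {x y : InvLimit α} {i j : ℕ} (hji : j ≤ i) (h : proj α i x = proj α i y) :
    proj α j x = proj α j y := by
  obtain ⟨f, hf⟩ := BondingComp.exists_of_le (α := α) hji
  rw [← hf.apply_proj, ← hf.apply_proj, h]

variable [∀ n, TopologicalSpace (V n)]

theorem continuous_proj (n : ℕ) : Continuous (proj α n) :=
  (continuous_apply n).comp continuous_subtype_val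

/-- A neighbourhood of a point of an inverse limit contains a fibre of a projection. -/
theorem exists_fiber_subset {U : Set (InvLimit α)} (hU : IsOpen U) {a : InvLimit α} (ha : a ∈ U) :
    ∃ n, ∀ x, proj α n x = proj α n a → x ∈ U := by
  obtain ⟨W, hW, rfl⟩ := isOpen_induced_iff.mp hU
  obtain ⟨I, u, hu, hsub⟩ := isOpen_pi_iff.mp hW a.1 ha
  -- A basic open set restricts finitely many coordinates, and the one of largest index determines
  -- the others.
  refine ⟨I.sup id, fun x hx => hsub fun i hi => ?_⟩
  have : proj α i x = proj α i a := proj_eq_of_le (Finset.le_sup (f := id) hi) hx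
  exact (congrArg (· ∈ u i) this).mpr (hu i hi).2

variable [∀ n, DiscreteTopology (V n)]

instance : T2Space (InvLimit α) :=
  inferInstanceAs (T2Space {x : ∀ n, V n // ∀ n, α n (x (n + 1)) = x n})

instance [∀ n, Finite (V n)] : CompactSpace (InvLimit α) := by
  have : IsClosed {x : ∀ n, V n | ∀ n, α n (x (n + 1)) = x n} := by
    simp only [ofPred_forall]
    exact isClosed_iInter fun n => isClosed_eq
      (continuous_of_discreteTopology.comp (continuous_apply _)) (continuous_apply _)
  exact isCompact_iff_compactSpace.mp this.isCompact

instance [∀ n, Finite (V n)] : SecondCountableTopology (InvLimit α) :=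
  have (n : ℕ) : SecondCountableTopology (V n) := inferInstance
  TopologicalSpace.Subtype.secondCountableTopology {x : ∀ n, V n | ∀ n, α n (x (n + 1)) = x n}

instance : TotallyDisconnectedSpace (InvLimit α) :=
  inferInstanceAs (TotallyDisconnectedSpace {x : ∀ n, V n // ∀ n, α n (x (n + 1)) = x n})

theorem isClosed_setOf_adj_proj (G : ∀ n, ReflGraph (V n)) (n : ℕ) :
    IsClosed {e : InvLimit α × InvLimit α | (G n).Adj (proj α n e.1) (proj α n e.2)} :=
  (isClosed_discrete {e : V n × V n | (G n).Adj e.1 e.2}).preimage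
    (((continuous_proj n).comp continuous_fst).prodMk ((continuous_proj n).comp continuous_snd))

theorem isTopologicalGraph [∀ n, Finite (V n)] (G : ∀ n, ReflGraph (V n)) :
    (graph α G).IsTopologicalGraph where
  compact := inferInstance
  hausdorff := inferInstance
  zeroDim := loc_compact_Haus_tot_disc_of_zero_dim
  secondCountable := inferInstance
  closed_edges := by
    simp only [graph, ofPred_forall]
    exact isClosed_iInter fun n => isClosed_setOf_adj_proj G n

/-- Connectedness at each finite level gives a pair in the two pieces that is adjacent up to that
level; compactness then yields one pair adjacent at all levels. -/
theorem isMonotoneEpi_proj [∀ n, Finite (V n)] {G : ∀ n, ReflGraph (V n)}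
    (h : ∀ n, ReflGraph.IsMonotoneEpi (G (n + 1)) (G n) (α n))
    (hepi : ∀ n, ReflGraph.IsEpi (graph α G) (G n) (proj α n)) (n : ℕ) :
    ReflGraph.IsMonotoneEpi (graph α G) (G n) (proj α n) := by
  refine ⟨hepi n, continuous_proj n, fun Q hQ hQc C D hC hD hsub hCn hDn => ?_⟩
  set S := proj α n ⁻¹' Q with hS
  have hSc : IsClosed S := hQ.preimage (continuous_proj n)
  -- Imposing adjacency at all levels `k ≤ m` makes the sequence decreasing by construction.
  let E : ℕ → Set (InvLimit α × InvLimit α) := fun m =>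
    ((S ∩ C) ×ˢ (S ∩ D)) ∩ ⋂ k ∈ Iic m, {e | (G k).Adj (proj α k e.1) (proj α k e.2)}
  have hEc : ∀ m, IsClosed (E m) := fun m =>
    ((hSc.inter hC).prod (hSc.inter hD)).inter
      (isClosed_biInter fun k _ => isClosed_setOf_adj_proj G k)
  have hEn : ∀ m, (E m).Nonempty := by
    intro m
    obtain ⟨g, hg⟩ := BondingComp.exists_of_le (α := α) (le_max_left n m)
    have hconn := (hg.isMonotoneEpi h).monotone Q hQ hQc
    have hmem : ∀ x, x ∈ S ↔ proj α (max n m) x ∈ g ⁻¹' Q := fun x => by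
      rw [hS, mem_preimage, mem_preimage, hg.apply_proj]
    obtain ⟨_, ⟨_, c, hc, rfl⟩, _, ⟨_, d, hd, rfl⟩, hcd⟩ :=
      hconn (proj α _ '' (S ∩ C)) (proj α _ '' (S ∩ D)) (isClosed_discrete _)
        (isClosed_discrete _)
        (fun q hq => by
          obtain ⟨z, rfl⟩ := (hepi _).surj q
          have hz := (hmem z).mpr hq
          exact (hsub hz).imp (fun h => ⟨z, ⟨hz, h⟩, rfl⟩) fun h => ⟨z, ⟨hz, h⟩, rfl⟩)
        (hCn.elim fun x hx => ⟨_, (hmem x).mp hx.1, x, hx, rfl⟩)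
        (hDn.elim fun x hx => ⟨_, (hmem x).mp hx.1, x, hx, rfl⟩)
    refine ⟨(c, d), ⟨hc, hd⟩, mem_iInter₂.mpr fun k hk => ?_⟩
    obtain ⟨p, hp⟩ := BondingComp.exists_of_le (α := α) (hk.out.trans (le_max_right n m))
    have := (hp.isMonotoneEpi h).epi.hom _ _ hcd
    rwa [hp.apply_proj, hp.apply_proj] at this
  obtain ⟨⟨c, d⟩, hcd⟩ := IsCompact.nonempty_iInter_of_sequence_nonempty_isCompact_isClosed E
    (fun m => inter_subset_inter_right _
      (biInter_subset_biInter_left (Iic_subset_Iic.mpr m.le_succ))) hEn (hEc 0).isCompact hEc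
  rw [mem_iInter] at hcd
  exact ⟨c, (hcd 0).1.1, d, (hcd 0).1.2, fun k => mem_iInter₂.mp (hcd k).2 k (mem_Iic.mpr le_rfl)⟩

/-- If the projections are monotone, then the fibres of the projections are connected
neighbourhoods, and a connected set is approximated by its unions with these. -/
theorem isKelley {G : ∀ n, ReflGraph (V n)} [Subsingleton (V 0)] [Nonempty (V 0)]
    (h : ∀ n, ReflGraph.IsMonotoneEpi (graph α G) (G n) (proj α n)) : (graph α G).IsKelley := by
  classical
  have hfib : ∀ n a, (graph α G).IsConn (proj α n ⁻¹' {a}) := fun n a =>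
    (h n).monotone _ (isClosed_discrete _) (ReflGraph.isConn_singleton _ a)
  obtain ⟨v⟩ := ‹Nonempty (V 0)›
  refine ⟨((h 0).epi.surj v).nonempty, ?_, fun K hKc hK a ha u hu => ?_⟩
  · convert hfib 0 v
    exact (eq_univ_of_forall fun x => Subsingleton.elim _ _).symm
  -- The deepest level up to `m` at which `u m` and `a` agree. The cap is needed since `u m = a` is
  -- possible; level `0` always qualifies because `V 0` is a single point.
  let d : ℕ → ℕ := fun m => Nat.findGreatest (fun n => proj α n (u m) = proj α n a) m
  have hd : ∀ m, proj α (d m) (u m) = proj α (d m) a := fun m =>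
    Nat.findGreatest_spec (P := fun n => proj α n (u m) = proj α n a) m.zero_le
      (Subsingleton.elim _ _)
  refine ⟨fun m => K ∪ proj α (d m) ⁻¹' {proj α (d m) a}, fun m => ⟨?_, ?_, Or.inr (hd m)⟩,
    fun U hU hKU => ?_, fun U _ hKU => ?_⟩
  · exact hKc.union ((isClosed_discrete _).preimage (continuous_proj _))
  · exact hK.union (hfib _ _) ha rfl
  · obtain ⟨n, hn⟩ := exists_fiber_subset hU (hKU ha)
    have hev : ∀ᶠ m in atTop, proj α n (u m) = proj α n a :=
      hu.eventually (((isOpen_discrete {proj α n a}).preimage (continuous_proj n)).mem_nhds rfl)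
    filter_upwards [hev, eventually_ge_atTop n] with m hm hnm
    refine union_subset hKU fun x hx => hn x (proj_eq_of_le ?_ hx)
    exact Nat.le_findGreatest (P := fun n => proj α n (u m) = proj α n a) hnm hm
  · exact Eventually.of_forall fun m => hKU.mono (inter_subset_inter_left _ subset_union_left)

end InvLimit

/-! ### Coordinates on the lattices `NC(n, 2)` -/

namespace NC

theorem ext_coords {n : ℕ} {π σ : NC n 2} (h1 : π.firstTwo = σ.firstTwo)
    (h2 : π.lastTwo = σ.lastTwo) : π = σ :=
  le_antisymm (show _ ∧ _ from ⟨h1.le, h2.le⟩) (show _ ∧ _ from ⟨h1.ge, h2.ge⟩)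

theorem firstTwo_le_lastTwo {n : ℕ} (π : NC n 2) : π.firstTwo ≤ π.lastTwo :=
  ((π.mem_twos_iff _).mp (Nat.sInf_mem π.twos_nonempty)).2

theorem firstTwo_pos {n : ℕ} (π : NC n 2) : 1 ≤ π.firstTwo := by
  by_contra h
  obtain ⟨_, h'⟩ := (π.mem_twos_iff 0).mpr ⟨by omega, by omega⟩
  exact h' (π.1.refl _)

theorem lastTwo_lt {n : ℕ} (π : NC n 2) : π.lastTwo < n :=
  ((π.mem_twos_iff _).mpr ⟨π.firstTwo_le_lastTwo, le_rfl⟩).1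

theorem coords_of_twos {n : ℕ} (π : NC n 2) {a b : ℕ} (hab : a ≤ b)
    (h : ∀ i, i ∈ π.twos ↔ a ≤ i ∧ i ≤ b) : π.firstTwo = a ∧ π.lastTwo = b := by
  have : π.twos = Icc a b := Set.ext h
  rw [firstTwo, lastTwo, this]
  exact ⟨csInf_Icc hab, csSup_Icc hab⟩

/-- The partition with blocks `{i | f ≤ i ≤ l}` and its complement. -/
def interval (n f l : ℕ) (hf : 1 ≤ f) (hfl : f ≤ l) (hl : l ≤ n + 1) : NC (n + 2) 2 :=
  ⟨Setoid.ker (fun i : Fin (n + 2) => f ≤ i ∧ i.1 ≤ l), by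
    intro a b c d hab hbc hcd h1 h2
    simp only [Setoid.ker_def, eq_iff_iff, Fin.lt_def] at *
    omega, by
    have hs : Function.Surjective (fun i : Fin (n + 2) => f ≤ i ∧ i.1 ≤ l) := by
      intro p
      by_cases hp : p
      · exact ⟨⟨f, by omega⟩, by simp [hp, hfl]⟩
      · exact ⟨0, by simp [hp]; omega⟩
    rw [Nat.card_congr (Setoid.quotientKerEquivOfSurjective _ hs)]
    simp⟩

theorem interval_coords {n f l : ℕ} (hf : 1 ≤ f) (hfl : f ≤ l) (hl : l ≤ n + 1) :
    (interval n f l hf hfl hl).firstTwo = f ∧ (interval n f l hf hfl hl).lastTwo = l := by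
  refine coords_of_twos _ hfl fun i => ?_
  have : i ∈ (interval n f l hf hfl hl).twos ↔
      ∃ _ : i < n + 2, ¬ ((f ≤ 0 ∧ 0 ≤ l) = (f ≤ i ∧ i ≤ l)) := Iff.rfl
  rw [this, eq_iff_iff]
  constructor
  · rintro ⟨h, h'⟩
    omega
  · intro h
    exact ⟨by omega, by omega⟩

@[simp] theorem firstTwo_interval {n f l : ℕ} (hf : 1 ≤ f) (hfl : f ≤ l) (hl : l ≤ n + 1) :
    (interval n f l hf hfl hl).firstTwo = f := (interval_coords hf hfl hl).1

@[simp] theorem lastTwo_interval {n f l : ℕ} (hf : 1 ≤ f) (hfl : f ≤ l) (hl : l ≤ n + 1) :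
    (interval n f l hf hfl hl).lastTwo = l := (interval_coords hf hfl hl).2

theorem lastSingleton_coords (n : ℕ) :
    (lastSingleton n).firstTwo = n + 1 ∧ (lastSingleton n).lastTwo = n + 1 := by
  refine coords_of_twos _ le_rfl fun i => ?_
  have : i ∈ (lastSingleton n).twos ↔ ∃ h : i < n + 2,
      ¬ (((⟨0, by omega⟩ : Fin (n + 2)) = Fin.last (n + 1)) =
        ((⟨i, h⟩ : Fin (n + 2)) = Fin.last (n + 1))) := Iff.rfl
  simp only [this, eq_iff_iff, Fin.ext_iff, Fin.val_last]
  constructor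
  · rintro ⟨h, h'⟩
    omega
  · intro h
    exact ⟨by omega, by omega⟩

/-- Some letter `2` survives the deletion, so `0` and `π.firstTwo` represent the two blocks. -/
theorem card_restrict {n : ℕ} (π : NC (n + 3) 2) (h : π.firstTwo ≤ n + 1) :
    Nat.card (Quotient (π.1.comap (Fin.castSucc : Fin (n + 2) → Fin (n + 3)))) = 2 := by
  have hl := π.firstTwo_le_lastTwo
  have hp := π.firstTwo_pos
  have hr : ∀ x y : Fin (n + 2), π.1.comap Fin.castSucc x y ↔
      ((π.firstTwo ≤ x ∧ x ≤ π.lastTwo) ↔ (π.firstTwo ≤ y ∧ y ≤ π.lastTwo)) := fun x y => by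
    rw [Setoid.comap_rel, rel_iff, mem_twos_iff, mem_twos_iff]
    rfl
  refine Nat.card_eq_two_iff.mpr ⟨Quotient.mk _ 0, Quotient.mk _ ⟨π.firstTwo, by omega⟩, ?_, ?_⟩
  · intro e
    have := (hr _ _).mp (Quotient.exact e)
    simp only [Fin.val_zero] at this
    omega
  · refine eq_univ_of_forall fun q => ?_
    induction q using Quotient.inductionOn with | _ x
    by_cases hx : π.firstTwo ≤ x ∧ x ≤ π.lastTwo
    · refine Or.inr (Quotient.sound ((hr _ _).mpr ?_))
      simp only []
      omega
    · refine Or.inl (Quotient.sound ((hr _ _).mpr ?_))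
      simp only [Fin.val_zero]
      omega

/-- Deleting the last letter cuts the interval of `2`s at `n + 1`. The exceptional value fits the
same formula: `(n + 2, n + 2)` goes to `(n + 1, n + 1)`. -/
theorem bond_coords {n : ℕ} (π : NC (n + 3) 2) :
    (bond n π).firstTwo = min π.firstTwo (n + 1) ∧
      (bond n π).lastTwo = min π.lastTwo (n + 1) := by
  have hl := π.firstTwo_le_lastTwo
  have hl' := π.lastTwo_lt
  by_cases h : Nat.card (Quotient (π.1.comap (Fin.castSucc : Fin (n + 2) → Fin (n + 3)))) = 2
  · let σ : NC (n + 2) 2 := ⟨π.1.comap Fin.castSucc, noncrossing_restrict π.1 π.2.1, h⟩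
    have hσ : bond n π = σ := dif_pos h
    rw [hσ]
    have key : ∀ i, i ∈ σ.twos ↔ i < n + 2 ∧ i ∈ π.twos := fun i =>
      ⟨fun ⟨h, h'⟩ => ⟨h, by omega, h'⟩, fun ⟨h, _, h'⟩ => ⟨h, h'⟩⟩
    -- A surviving `2` forces `π.firstTwo ≤ n + 1`; otherwise truncation would give `{n + 1}` in
    -- place of the empty interval.
    obtain ⟨i, hi⟩ := σ.twos_nonempty
    simp only [mem_twos_iff π] at key
    have := (key i).mp hi
    refine coords_of_twos σ (by omega) fun i => ?_
    rw [key]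
    omega
  · have : n + 1 < π.firstTwo := by
      by_contra! h'
      exact h (card_restrict π h')
    have hσ : bond n π = lastSingleton n := dif_neg h
    rw [hσ, (lastSingleton_coords n).1, (lastSingleton_coords n).2]
    omega

@[simp] theorem firstTwo_bond {n : ℕ} (π : NC (n + 3) 2) :
    (bond n π).firstTwo = min π.firstTwo (n + 1) := (bond_coords π).1

@[simp] theorem lastTwo_bond {n : ℕ} (π : NC (n + 3) 2) :
    (bond n π).lastTwo = min π.lastTwo (n + 1) := (bond_coords π).2

/-! ### Order and Hasse diagram in coordinates -/

theorem le_iff {n : ℕ} {π σ : NC n 2} :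
    π ≤ σ ↔ π.firstTwo ≤ σ.firstTwo ∧ π.lastTwo ≤ σ.lastTwo := Iff.rfl

/-- The sum of the coordinates acts as a rank. -/
theorem lt_iff {n : ℕ} {π σ : NC n 2} :
    π < σ ↔ π.firstTwo ≤ σ.firstTwo ∧ π.lastTwo ≤ σ.lastTwo ∧
      π.firstTwo + π.lastTwo < σ.firstTwo + σ.lastTwo := by
  rw [lt_iff_le_not_ge, le_iff, le_iff]
  omega

theorem covBy_iff {n : ℕ} {π σ : NC (n + 2) 2} :
    π ⋖ σ ↔ π.firstTwo ≤ σ.firstTwo ∧ π.lastTwo ≤ σ.lastTwo ∧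
      π.firstTwo + π.lastTwo + 1 = σ.firstTwo + σ.lastTwo := by
  have h1 := π.firstTwo_le_lastTwo
  have h2 := π.firstTwo_pos
  have h3 := σ.firstTwo_le_lastTwo
  have h4 := σ.lastTwo_lt
  constructor
  · rintro ⟨h, hc⟩
    rw [lt_iff] at h
    refine ⟨h.1, h.2.1, ?_⟩
    by_contra hne
    -- If the sum grows by more than one, a unit step from `π` towards `σ` lies strictly between.
    -- Raising `lastTwo` always stays in the triangle; if the last positions agree, raising
    -- `firstTwo` does, since `π.firstTwo < σ.firstTwo ≤ σ.lastTwo = π.lastTwo`.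
    rcases h.2.1.eq_or_lt with he | hlt
    · refine @hc (interval n (π.firstTwo + 1) π.lastTwo (by omega) (by omega) (by omega)) ?_ ?_ <;>
      · rw [lt_iff]
        simp only [firstTwo_interval, lastTwo_interval]
        omega
    · refine @hc (interval n π.firstTwo (π.lastTwo + 1) (by omega) (by omega) (by omega)) ?_ ?_ <;>
      · rw [lt_iff]
        simp only [firstTwo_interval, lastTwo_interval]
        omega
  · intro h
    refine ⟨lt_iff.mpr (by omega), fun τ h5 h6 => ?_⟩
    rw [lt_iff] at h5 h6
    omega

theorem hasse_adj_iff {n : ℕ} {π σ : NC (n + 2) 2} :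
    (ReflGraph.hasse (NC (n + 2) 2)).Adj π σ ↔
      (π.firstTwo = σ.firstTwo ∧ (π.lastTwo ≤ σ.lastTwo + 1 ∧ σ.lastTwo ≤ π.lastTwo + 1)) ∨
      (π.lastTwo = σ.lastTwo ∧ (π.firstTwo ≤ σ.firstTwo + 1 ∧ σ.firstTwo ≤ π.firstTwo + 1)) := by
  have heq : π = σ ↔ π.firstTwo = σ.firstTwo ∧ π.lastTwo = σ.lastTwo :=
    ⟨fun h => h ▸ ⟨rfl, rfl⟩, fun h => ext_coords h.1 h.2⟩
  simp only [ReflGraph.hasse, covBy_iff, heq]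
  omega

theorem exists_isLUB {n : ℕ} (π σ : NC (n + 2) 2) : ∃ τ, IsLUB {π, σ} τ := by
  have h1 := π.firstTwo_le_lastTwo
  have h2 := π.firstTwo_pos
  have h3 := π.lastTwo_lt
  have h4 := σ.firstTwo_le_lastTwo
  have h5 := σ.lastTwo_lt
  refine ⟨interval n (max π.firstTwo σ.firstTwo) (max π.lastTwo σ.lastTwo) (by omega) (by omega)
    (by omega), ?_, fun τ hτ => ?_⟩
  · rintro ρ (rfl | rfl) <;> simp [le_iff]
  · have hπ := le_iff.mp (hτ (Or.inl rfl))
    have hσ := le_iff.mp (hτ (Or.inr rfl))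
    rw [le_iff]
    simp only [firstTwo_interval, lastTwo_interval]
    omega

theorem exists_isGLB {n : ℕ} (π σ : NC (n + 2) 2) : ∃ τ, IsGLB {π, σ} τ := by
  have h1 := π.firstTwo_le_lastTwo
  have h2 := π.firstTwo_pos
  have h3 := π.lastTwo_lt
  have h4 := σ.firstTwo_le_lastTwo
  have h5 := σ.firstTwo_pos
  refine ⟨interval n (min π.firstTwo σ.firstTwo) (min π.lastTwo σ.lastTwo) (by omega) (by omega)
    (by omega), ?_, fun τ hτ => ?_⟩
  · rintro ρ (rfl | rfl) <;> simp [le_iff]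
  · have hπ := le_iff.mp (hτ (Or.inl rfl))
    have hσ := le_iff.mp (hτ (Or.inr rfl))
    rw [le_iff]
    simp only [firstTwo_interval, lastTwo_interval]
    omega

/-- Adding a letter `1` at the end of the restricted growth function. -/
noncomputable def extend {n : ℕ} (π : NC (n + 2) 2) : NC (n + 3) 2 :=
  interval (n + 1) π.firstTwo π.lastTwo π.firstTwo_pos π.firstTwo_le_lastTwo
    (by have := π.lastTwo_lt; omega)

@[simp] theorem firstTwo_extend {n : ℕ} (π : NC (n + 2) 2) : π.extend.firstTwo = π.firstTwo :=
  firstTwo_interval _ _ _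

@[simp] theorem lastTwo_extend {n : ℕ} (π : NC (n + 2) 2) : π.extend.lastTwo = π.lastTwo :=
  lastTwo_interval _ _ _

theorem bond_extend {n : ℕ} (π : NC (n + 2) 2) : bond n π.extend = π := by
  have h1 := π.firstTwo_le_lastTwo
  have h2 := π.lastTwo_lt
  apply ext_coords
  · simp only [firstTwo_bond, firstTwo_extend]
    omega
  · simp only [lastTwo_bond, lastTwo_extend]
    omega

theorem hasse_adj_extend {n : ℕ} (π σ : NC (n + 2) 2) :
    (ReflGraph.hasse (NC (n + 3) 2)).Adj π.extend σ.extend ↔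
      (ReflGraph.hasse (NC (n + 2) 2)).Adj π σ := by
  rw [hasse_adj_iff (n := n + 1), hasse_adj_iff]
  simp

/-! ### Bonding maps and projections of the limit -/

theorem bond_mono (n : ℕ) : Monotone (bond n) := fun π σ h => by
  rw [le_iff] at h ⊢
  simp only [firstTwo_bond, lastTwo_bond]
  omega

/-- Truncation preserves equal coordinates and does not increase differences, so edges go to edges;
`extend` is a section that lifts edges. -/
theorem isEpi_bond (n : ℕ) :
    ReflGraph.IsEpi (ReflGraph.hasse (NCTwo (n + 1))) (ReflGraph.hasse (NCTwo n)) (bond n) where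
  hom π σ h := by
    rw [hasse_adj_iff (n := n + 1)] at h
    rw [hasse_adj_iff]
    simp only [firstTwo_bond, lastTwo_bond]
    omega
  surj π := ⟨_, bond_extend π⟩
  surj_edge π σ h := ⟨_, _, (hasse_adj_extend π σ).mpr h, bond_extend π, bond_extend σ⟩

/-- Every partition is joined to `extend` of its restriction by a path in a fibre of `bond`. -/
theorem reflTransGen_extend_bond {n : ℕ} (π : NC (n + 3) 2) :
    Relation.ReflTransGen (fun a b => (ReflGraph.hasse (NCTwo (n + 1))).Adj a b ∧
      bond n b = bond n a) π (bond n π).extend := by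
  have h1 := π.firstTwo_le_lastTwo
  have h2 := π.firstTwo_pos
  have h3 := π.lastTwo_lt
  -- Truncate `firstTwo` before `lastTwo`, so that the intermediate pair remains an interval. Each
  -- move is by at most one.
  refine Relation.ReflTransGen.tail (b := interval (n + 1) (min π.firstTwo (n + 1)) π.lastTwo
    (by omega) (by omega) (by omega)) (Relation.ReflTransGen.single ⟨?_, ?_⟩) ⟨?_, ?_⟩
  · rw [hasse_adj_iff (n := n + 1)]
    simp only [firstTwo_interval, lastTwo_interval, true_and]
    omega
  · apply ext_coords <;> simp
  · rw [hasse_adj_iff (n := n + 1)]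
    simp only [firstTwo_interval, lastTwo_interval, firstTwo_extend, lastTwo_extend, firstTwo_bond,
      lastTwo_bond, true_and]
    omega
  · apply ext_coords <;> simp

theorem isMonotoneEpi_bond (n : ℕ) :
    ReflGraph.IsMonotoneEpi (ReflGraph.hasse (NCTwo (n + 1))) (ReflGraph.hasse (NCTwo n))
      (bond n) := by
  refine (isEpi_bond n).isMonotoneEpi_of_fibers fun π σ h => ?_
  -- Points of one fibre share the endpoint `extend` of their common image: follow one path and
  -- return along the other, reversed.
  have hσ := reflTransGen_extend_bond σ
  rw [← h] at hσ
  refine (reflTransGen_extend_bond π).trans ?_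
  exact Relation.ReflTransGen.mono
    (fun a b hab => ⟨ReflGraph.symm _ _ _ hab.1, hab.2.symm⟩) _ _
    (Relation.reflTransGen_swap.mpr hσ)

/-- The point of the limit with given first and last occurrence of the letter `2`. -/
def limitPoint (f l : ℕ) (hf : 1 ≤ f) (hfl : f ≤ l) : NCLimit :=
  ⟨fun n => interval n (min f (n + 1)) (min l (n + 1)) (by omega) (by omega) (by omega), fun n => by
    apply ext_coords <;> simp⟩

theorem proj_limitPoint {n : ℕ} (π : NCTwo n) :
    InvLimit.proj (V := NCTwo) bond n
      (limitPoint π.firstTwo π.lastTwo π.firstTwo_pos π.firstTwo_le_lastTwo) = π := by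
  have h1 := π.firstTwo_le_lastTwo
  have h2 := π.lastTwo_lt
  apply ext_coords
  · simp only [InvLimit.proj, limitPoint, firstTwo_interval]
    omega
  · simp only [InvLimit.proj, limitPoint, lastTwo_interval]
    omega

theorem isEpi_proj (n : ℕ) : ReflGraph.IsEpi ncLimitGraph (ReflGraph.hasse (NCTwo n))
    (InvLimit.proj (V := NCTwo) bond n) where
  hom _ _ h := h n
  surj π := ⟨_, proj_limitPoint π⟩
  surj_edge π σ h := by
    -- The ends are lifted with unchanged coordinates; truncation at any level `k` keeps them
    -- adjacent.
    refine ⟨_, _, fun k => ?_, proj_limitPoint π, proj_limitPoint σ⟩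
    rw [hasse_adj_iff] at h ⊢
    simp only [InvLimit.proj, limitPoint, firstTwo_interval, lastTwo_interval]
    omega

theorem isMonotoneEpi_proj (n : ℕ) :
    ReflGraph.IsMonotoneEpi ncLimitGraph (ReflGraph.hasse (NCTwo n))
      (InvLimit.proj (V := NCTwo) bond n) :=
  InvLimit.isMonotoneEpi_proj isMonotoneEpi_bond isEpi_proj n

instance : Subsingleton (NCTwo 0) := ⟨fun π σ => by
  have h1 := π.firstTwo_le_lastTwo
  have h2 := π.firstTwo_pos
  have h3 := π.lastTwo_lt
  have h4 := σ.firstTwo_le_lastTwo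
  have h5 := σ.firstTwo_pos
  have h6 := σ.lastTwo_lt
  exact ext_coords (by omega) (by omega)⟩

end NC

theorem mainTheorem10 :
    -- each `NC(n, 2)`, `n ≥ 2`, is a finite nonempty lattice
    (∀ n : ℕ, Finite (NCTwo n) ∧ Nonempty (NCTwo n) ∧
      ∀ π σ : NCTwo n, (∃ τ, IsLUB {π, σ} τ) ∧ (∃ τ, IsGLB {π, σ} τ)) ∧
    -- `NC(n + 1, 2)` contains a copy of `NC(n, 2)`, onto which the bonding map retracts
    (∀ n : ℕ, ∃ e : NCTwo n ↪o NCTwo (n + 1),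
      (∀ π σ, (ReflGraph.hasse (NCTwo (n + 1))).Adj (e π) (e σ) ↔
        (ReflGraph.hasse (NCTwo n)).Adj π σ) ∧
      ∀ π, NC.bond n (e π) = π) ∧
    -- the bonding maps are order preserving and monotone epimorphisms of graphs
    (∀ n : ℕ, Monotone (NC.bond n) ∧
      ReflGraph.IsMonotoneEpi (ReflGraph.hasse (NCTwo (n + 1))) (ReflGraph.hasse (NCTwo n))
        (NC.bond n)) ∧
    -- with the compositions of the bonding maps the lattices form a projective Fraïssé family
    ReflGraph.IsProjectiveFraisse (fun n : ℕ => ReflGraph.hasse (NCTwo n))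
      (BondingComp (V := NCTwo) NC.bond) ∧
    -- the projective limit is a topological graph, whose projections are monotone
    ncLimitGraph.IsTopologicalGraph ∧
    (∀ n : ℕ, ReflGraph.IsMonotoneEpi ncLimitGraph (ReflGraph.hasse (NCTwo n))
      (InvLimit.proj (V := NCTwo) NC.bond n)) ∧
    -- and it is Kelley
    ncLimitGraph.IsKelley := by
  have : Nonempty (NCTwo 0) := ⟨NC.lastSingleton 0⟩
  refine ⟨fun n => ⟨inferInstance, ⟨NC.lastSingleton n⟩, fun π σ =>
      ⟨NC.exists_isLUB π σ, NC.exists_isGLB π σ⟩⟩,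
    fun n => ⟨OrderEmbedding.ofMapLEIff NC.extend fun π σ => ?_, NC.hasse_adj_extend,
      NC.bond_extend⟩,
    fun n => ⟨NC.bond_mono n, NC.isMonotoneEpi_bond n⟩,
    BondingComp.isProjectiveFraisse NC.isEpi_bond fun n => (NC.isEpi_proj n).surj,
    InvLimit.isTopologicalGraph _, NC.isMonotoneEpi_proj, InvLimit.isKelley NC.isMonotoneEpi_proj⟩
  rw [NC.le_iff, NC.le_iff]
  simp
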